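/- Let $G$ be a (simple, possibly infinite, not necessarily connected) graph with edge set $E(G)$ and let $\ell:E(G)\to\mathbb R_{>0}$ be an assignment of edge lengths. Regard $G$ as a 1-complex in which each edge $e$ is a copy of the real interval $[0,\ell(e)]$. For points $x,y$ of this 1-complex let $d_\ell(x,y)\in[0,\infty]$ be the infimum of the lengths of the arcs from $x$ to $y$ in $G$, where the length of an arc is the sum of the lengths of the edges and maximal half-edges it consists of (so $d_\ell(x,x)=0$, for vertices $x,y$ it is the infimum of $\sum_{e\in E(P)}\ell(e)$ over all $x$--$y$ paths $P$ in $G$, and $d_\ell(x,y)=\infty$ if $x,y$ lie in different components of $G$). Let $|G|_\ell$ be the completion of the space obtained from $G$ by identifying points at distance $0$. A half-edge is a connected subset of an edge; its length is that of the corresponding subinterval of $[0,\ell(e)]$. An arc (a circle) in $|G|_\ell$ is a subset homeomorphic to $[0,1]$ (to the unit circle $S^1$). The length $\ell(C)$ of an arc or circle $C$ is the length $\sup\sum_{i} d_\ell(\gamma(s_i),\gamma(s_{i+1}))$, the supremum being taken over all finite sequences $0=s_1<s_2<\dots<s_k=1$, of a continuous surjective map $\gamma:[0,1]\to C$ that is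 injective on $(0,1)$; part of the claim below is that it does not depend on the choice of $\gamma$. Let $E(C)$ denote the set of edges contained in $C$. **Lemma.** Suppose that $\sum_{e\in E(G)}\ell(e)<\infty$. Then: 1. for every circle $C$ in $|G|_\ell$ we have $\ell(C)=\sum_{e\in E(C)}\ell(e)$; 2. for every arc $C$ in $|G|_\ell$ neither of whose endpoints is an inner point of an edge we have $\ell(C)=\sum_{e\in E(C)}\ell(e)$; 3. for every arc $C$ in $|G|_\ell$ the length $\ell(C)$ is the sum of the lengths of the maximal half-edges contained in $C$ (a full edge contained in $C$ counting as a half-edge). -/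

import Mathlib

open Set Filter Topology
open scoped ENNReal

/-! ### Arcs, circles and their lengths -/

section Curves

variable {X : Type*}

/-- An arc: a homeomorphic image of the interval `[0, 1]`. -/
def IsArc [TopologicalSpace X] (C : Set X) : Prop := Nonempty (unitInterval ≃ₜ C)

/-- A circle: a homeomorphic copy of the unit circle. -/
def IsCircle [TopologicalSpace X] (C : Set X) : Prop := Nonempty (Circle ≃ₜ C)

/-- The endpoints of an arc `C`: the images of `0` and `1` under a homeomorphism `[0, 1] ≃ C`. -/
def IsEndpoint [TopologicalSpace X] (C : Set X) (x : X) : Prop :=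
  ∃ h : unitInterval ≃ₜ C, (h 0 : X) = x ∨ (h 1 : X) = x

/-- A surjective topological path `[0, 1] → C` that is injective on `(0, 1)`. -/
structure IsParametrization [TopologicalSpace X] (C : Set X) (γ : unitInterval → X) : Prop where
  continuous : Continuous γ
  range_eq : range γ = C
  injOn : InjOn γ (Ioo 0 1)

/-- The length of a topological path `γ : [0, 1] → X`: the supremum of the sums
`∑ d(γ sᵢ, γ sᵢ₊₁)` over all finite increasing sequences in `[0, 1]`. -/
noncomputable def pathLength [PseudoEMetricSpace X] (γ : unitInterval → X) : ℝ≥0∞ := eVariationOn γ univ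

/-- `C` has length `L`: there is a surjective path `[0, 1] → C` injective on `(0, 1)`, and every
such path has length `L`. -/
def HasLength [PseudoEMetricSpace X] (C : Set X) (L : ℝ≥0∞) : Prop :=
  (∃ γ : unitInterval → X, IsParametrization C γ) ∧ ∀ γ : unitInterval → X, IsParametrization C γ → pathLength γ = L

end Curves

/-! ### The completion of a space with a (possibly infinite) pseudometric -/

section Completion

/-- The Cauchy sequences of `X`. -/
def CauchySequences (X : Type*) [PseudoEMetricSpace X] : Type _ := {u : ℕ → X // CauchySeq u}

/-- The distance of two Cauchy sequences is the limit (here written as a `limsup`) of the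
distances of their terms. -/
noncomputable instance (X : Type*) [PseudoEMetricSpace X] :
    PseudoEMetricSpace (CauchySequences X) where
  edist u v := limsup (fun n => edist (u.1 n) (v.1 n)) atTop
  edist_self u := by simp
  edist_comm u v := by simp only [edist_comm]
  edist_triangle u v w := by
    refine le_trans (limsup_le_limsup (Eventually.of_forall fun n =>
      edist_triangle (u.1 n) (v.1 n) (w.1 n))) ?_
    have h : ∀ p : ℕ → ℝ≥0∞, ∀ q : ℕ → ℝ≥0∞, limsup (fun n => p n + q n) atTop ≤
        limsup p atTop + limsup q atTop := fun p q => by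
      refine ENNReal.le_of_forall_pos_le_add fun ε hε hfin => ?_
      have hp := ENNReal.lt_add_right (ne_top_of_le_ne_top hfin.ne le_self_add)
        (ENNReal.half_pos (ENNReal.coe_pos.2 hε).ne').ne'
      have hq := ENNReal.lt_add_right (ne_top_of_le_ne_top hfin.ne le_add_self)
        (ENNReal.half_pos (ENNReal.coe_pos.2 hε).ne').ne'
      refine limsup_le_of_le (by isBoundedDefault) ?_
      filter_upwards [eventually_lt_of_limsup_lt hp, eventually_lt_of_limsup_lt hq] with n h₁ h₂
      refine (add_le_add h₁.le h₂.le).trans (le_of_eq ?_)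
      rw [add_add_add_comm, ENNReal.add_halves]
    exact h _ _

/-- The completion of `X`: Cauchy sequences, identified when their distance is `0`. In particular
two points of `X` at distance `0` give the same point of the completion. -/
def MetricCompletion (X : Type*) [PseudoEMetricSpace X] : Type _ :=
  SeparationQuotient (CauchySequences X)

noncomputable instance (X : Type*) [PseudoEMetricSpace X] : EMetricSpace (MetricCompletion X) :=
  inferInstanceAs (EMetricSpace (SeparationQuotient (CauchySequences X)))

/-- The point of the completion represented by a Cauchy sequence. -/
noncomputable def MetricCompletion.mk {X : Type*} [PseudoEMetricSpace X] (u : CauchySequences X) :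
    MetricCompletion X := SeparationQuotient.mk u

/-- The canonical map of `X` into its completion, by constant sequences. -/
noncomputable def MetricCompletion.of {X : Type*} [PseudoEMetricSpace X] (x : X) : MetricCompletion X :=
  MetricCompletion.mk ⟨fun _ => x, cauchySeq_const x⟩

theorem MetricCompletion.isometry_of {X : Type*} [PseudoEMetricSpace X] :
    Isometry (MetricCompletion.of : X → MetricCompletion X) := fun x y => by
  change limsup (fun _ : ℕ => edist x y) atTop = _
  simp

theorem MetricCompletion.tendsto_of {X : Type*} [PseudoEMetricSpace X] (u : CauchySequences X) :
    Tendsto (fun n => MetricCompletion.of (u.1 n)) atTop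
      (𝓝 (MetricCompletion.mk u)) := by
  refine EMetric.tendsto_atTop.2 fun ε hε => ?_
  obtain ⟨δ, hδ, hδε⟩ := exists_between hε
  obtain ⟨N, hN⟩ := EMetric.cauchySeq_iff.1 u.2 δ hδ
  refine ⟨N, fun n hn => lt_of_le_of_lt ?_ hδε⟩
  change limsup (fun k => edist (u.1 n) (u.1 k)) atTop ≤ δ
  exact limsup_le_of_le (by isBoundedDefault)
    (eventually_atTop.2 ⟨N, fun k hk => (hN n hn k hk).le⟩)

theorem MetricCompletion.denseRange_of {X : Type*} [PseudoEMetricSpace X] :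
    DenseRange (MetricCompletion.of : X → MetricCompletion X) := by
  intro z
  obtain ⟨u, rfl⟩ := SeparationQuotient.surjective_mk z
  exact mem_closure_of_tendsto (MetricCompletion.tendsto_of u)
    (Eventually.of_forall fun n => mem_range_self _)

instance (X : Type*) [PseudoEMetricSpace X] : CompleteSpace (MetricCompletion X) := by
  refine EMetric.complete_of_cauchySeq_tendsto fun z hz => ?_
  have hpos : ∀ n : ℕ, (0 : ℝ≥0∞) < ((n : ℝ≥0∞) + 1)⁻¹ := fun n => by simp
  have hx : ∀ n, ∃ x : X, edist (z n) (MetricCompletion.of x) < ((n : ℝ≥0∞) + 1)⁻¹ := fun n => by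
    obtain ⟨_, ⟨x, rfl⟩, hx⟩ := EMetric.mem_closure_iff.1 (MetricCompletion.denseRange_of (z n))
      _ (hpos n)
    exact ⟨x, hx⟩
  choose x hx using hx
  have hlim : Tendsto (fun n => edist (z n) (MetricCompletion.of (x n))) atTop (𝓝 0) := by
    refine tendsto_of_tendsto_of_tendsto_of_le_of_le tendsto_const_nhds
      (?_ : Tendsto (fun n : ℕ => ((n : ℝ≥0∞) + 1)⁻¹) atTop (𝓝 0))
      (fun n => zero_le) (fun n => (hx n).le)
    have := ENNReal.tendsto_inv_nat_nhds_zero.comp (tendsto_add_atTop_nat 1)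
    refine this.congr fun n => ?_
    simp
  have hxc : CauchySeq x := by
    refine EMetric.cauchySeq_iff.2 fun ε hε => ?_
    have hε3 : 0 < ε / 3 := ENNReal.div_pos hε.ne' (by simp)
    obtain ⟨N, hN⟩ := EMetric.cauchySeq_iff.1 hz _ hε3
    obtain ⟨M, hM⟩ := eventually_atTop.1 (hlim.eventually (gt_mem_nhds hε3))
    refine ⟨max M N, fun m hm n hn => ?_⟩
    rw [← MetricCompletion.isometry_of (x m) (x n)]
    refine lt_of_le_of_lt (edist_triangle4 _ (z m) (z n) _) ?_
    rw [edist_comm _ (z m), ← ENNReal.add_thirds ε]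
    exact ENNReal.add_lt_add (ENNReal.add_lt_add (hM m (le_of_max_le_left hm))
      (hN m (le_of_max_le_right hm) n (le_of_max_le_right hn))) (hM n (le_of_max_le_left hn))
  refine ⟨MetricCompletion.mk ⟨x, hxc⟩, ?_⟩
  refine tendsto_iff_edist_tendsto_0.2 ?_
  refine tendsto_of_tendsto_of_tendsto_of_le_of_le tendsto_const_nhds
    (by simpa using hlim.add (tendsto_iff_edist_tendsto_0.1 (MetricCompletion.tendsto_of ⟨x, hxc⟩)))
    (fun n => zero_le) (fun n => edist_triangle _ _ _)

end Completion

/-! ### A graph with edge lengths as a 1-complex, and its completion -/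

namespace LengthGraph

variable {V : Type*} {G : SimpleGraph V}

/-- The first endvertex of an edge, in an arbitrarily fixed orientation. -/
noncomputable def src (e : G.edgeSet) : V := (Quot.out (e : Sym2 V)).1

/-- The second endvertex of an edge. -/
noncomputable def tgt (e : G.edgeSet) : V := (Quot.out (e : Sym2 V)).2

theorem mk_src_tgt (e : G.edgeSet) : s(src e, tgt e) = (e : Sym2 V) := Quot.out_eq _

theorem adj_src_tgt (e : G.edgeSet) : G.Adj (src e) (tgt e) := by
  rw [← SimpleGraph.mem_edgeSet, mk_src_tgt]; exact e.2

/-- The points of the 1-complex `G`: the vertices, and the inner points of edges. Every edge `e` is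
a copy of the interval `[0, ℓ e]`, the number `t` being the distance from `src e` along `e`. -/
inductive Point (G : SimpleGraph V) (ℓ : G.edgeSet → ℝ)
  | vertex (v : V) : Point G ℓ
  | inner (e : G.edgeSet) (t : ℝ) (h₀ : 0 < t) (h₁ : t < ℓ e) : Point G ℓ

variable (ℓ : G.edgeSet → ℝ)

/-- The length of a walk, the sum of the lengths of its edges. -/
noncomputable def walkLength {u v : V} (p : G.Walk u v) : ℝ≥0∞ :=
  (p.darts.map fun d => ENNReal.ofReal (ℓ ⟨d.edge, d.edge_mem⟩)).sum

/-- `d(u, v)` for vertices: the infimum of the lengths of the `u`-`v` paths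
(`∞` if there is no such path). -/
noncomputable def vertexDist (u v : V) : ℝ≥0∞ :=
  ⨅ (p : G.Walk u v) (_ : p.IsPath), walkLength ℓ p

open Classical in
/-- The length of the half-edge (or edge-free trivial piece) from `x` to the vertex `a`: for an
inner point `x` of an edge it is finite precisely for the two endvertices `a` of that edge, for a
vertex `x` it is finite (and `0`) only for `a = x`. -/
noncomputable def toVertex : Point G ℓ → V → ℝ≥0∞
  | .vertex v, a => if a = v then 0 else ⊤
  | .inner e t _ _, a =>
      if a = src e then ENNReal.ofReal t
      else if a = tgt e then ENNReal.ofReal (ℓ e - t) else ⊤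

open Classical in
/-- The length of the segment between two inner points of one edge (`∞` for all other pairs). -/
noncomputable def segmentDist : Point G ℓ → Point G ℓ → ℝ≥0∞
  | .inner e s _ _, .inner f t _ _ => if e = f then ENNReal.ofReal |s - t| else ⊤
  | .inner _ _ _ _, .vertex _ => ⊤
  | .vertex _, _ => ⊤

/-- The infimum of the lengths of the connections that leave `x` along a half-edge to a vertex `a`,
follow a path of `G` from `a` to `b`, and reach `y` along a half-edge. -/
noncomputable def throughDist (x y : Point G ℓ) : ℝ≥0∞ :=
  ⨅ (a : V) (b : V), toVertex ℓ x a + vertexDist ℓ a b + toVertex ℓ y b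

/-- The distance `d_ℓ(x, y)`: the infimum of the lengths of the arcs from `x` to `y` in the
1-complex `G`. Such an arc is a segment of one edge or consists of a path of `G` and at most two
half-edges. -/
noncomputable def pointDist (x y : Point G ℓ) : ℝ≥0∞ := min (segmentDist ℓ x y) (throughDist ℓ x y)

theorem vertexDist_le_walkLength {u v : V} (p : G.Walk u v) :
    vertexDist ℓ u v ≤ walkLength ℓ p := by
  classical
  refine le_trans (iInf₂_le p.bypass p.bypass_isPath) ?_
  exact (p.darts_bypass_sublist_darts.map _).sum_le_sum (fun _ _ => zero_le)

theorem vertexDist_self (u : V) : vertexDist ℓ u u = 0 :=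
  le_antisymm (le_trans (vertexDist_le_walkLength ℓ .nil) (by simp [walkLength])) (zero_le)

theorem vertexDist_le_symm (u v : V) : vertexDist ℓ v u ≤ vertexDist ℓ u v := by
  refine le_iInf₂ fun p _ => le_trans (vertexDist_le_walkLength ℓ p.reverse) (le_of_eq ?_)
  simp [walkLength, Function.comp_def, List.sum_reverse]

theorem vertexDist_comm (u v : V) : vertexDist ℓ u v = vertexDist ℓ v u :=
  le_antisymm (vertexDist_le_symm ℓ v u) (vertexDist_le_symm ℓ u v)

theorem vertexDist_triangle (u v w : V) :
    vertexDist ℓ u w ≤ vertexDist ℓ u v + vertexDist ℓ v w := by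
  conv_rhs => rw [vertexDist, vertexDist]
  simp only [ENNReal.iInf_add, ENNReal.add_iInf]
  refine le_iInf₂ fun q _ => le_iInf₂ fun p _ =>
    le_trans (vertexDist_le_walkLength ℓ (p.append q)) (le_of_eq ?_)
  simp [walkLength]

theorem vertexDist_src_tgt (e : G.edgeSet) :
    vertexDist ℓ (src e) (tgt e) ≤ ENNReal.ofReal (ℓ e) := by
  refine le_trans (vertexDist_le_walkLength ℓ (.cons (adj_src_tgt e) .nil)) (le_of_eq ?_)
  have h : (⟨s(src e, tgt e), adj_src_tgt e⟩ : G.edgeSet) = e := Subtype.ext (mk_src_tgt e)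
  simp [walkLength, SimpleGraph.Dart.edge, h]

theorem vertexDist_le_toVertex_add (y : Point G ℓ) (b c : V) :
    vertexDist ℓ b c ≤ toVertex ℓ y b + toVertex ℓ y c := by
  cases y with
  | vertex v =>
    simp only [toVertex]
    split_ifs with h₁ h₂ h₃
    · simp [h₁, h₂, vertexDist_self]
    all_goals simp
  | inner e t h₀ h₁ =>
    have key : ENNReal.ofReal t + ENNReal.ofReal (ℓ e - t) = ENNReal.ofReal (ℓ e) := by
      rw [← ENNReal.ofReal_add h₀.le (by linarith)]; congr 1; ring
    have h := vertexDist_src_tgt ℓ e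
    simp only [toVertex]
    split_ifs with hb hc hc hb' hc hc
    all_goals (try subst hb); (try subst hc); (try subst hb')
    all_goals first
      | simp; done
      | (simp [vertexDist_self]; done)
      | (rw [key]; exact h)
      | (rw [vertexDist_comm, add_comm, key]; exact h)

theorem toVertex_le_segmentDist_add (x y : Point G ℓ) (a : V) :
    toVertex ℓ x a ≤ segmentDist ℓ x y + toVertex ℓ y a := by
  cases x <;> cases y <;> simp only [segmentDist, top_add, le_top]
  rename_i e s hs₀ hs₁ f t ht₀ ht₁
  split_ifs with h
  · subst h
    simp only [toVertex]
    split_ifs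
    · rw [← ENNReal.ofReal_add (abs_nonneg _) ht₀.le]
      exact ENNReal.ofReal_le_ofReal (by linarith [le_abs_self (s - t)])
    · rw [← ENNReal.ofReal_add (abs_nonneg _) (by linarith)]
      exact ENNReal.ofReal_le_ofReal (by linarith [neg_abs_le (s - t)])
    · simp
  · simp

theorem segmentDist_comm (x y : Point G ℓ) : segmentDist ℓ x y = segmentDist ℓ y x := by
  cases x <;> cases y <;> simp only [segmentDist]
  rename_i e s _ _ f t _ _
  by_cases h : e = f
  · rw [if_pos h, if_pos h.symm, abs_sub_comm]
  · rw [if_neg h, if_neg (Ne.symm h)]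

theorem segmentDist_triangle (x y z : Point G ℓ) :
    segmentDist ℓ x z ≤ segmentDist ℓ x y + segmentDist ℓ y z := by
  cases x <;> cases y <;> cases z <;> simp only [segmentDist, top_add, add_top, le_top]
  split_ifs with h₁ h₂ h₃ h₄ h₅ <;> try simp
  · rw [← ENNReal.ofReal_add (abs_nonneg _) (abs_nonneg _)]
    exact ENNReal.ofReal_le_ofReal (abs_sub_le _ _ _)
  · simp_all

theorem throughDist_comm (x y : Point G ℓ) : throughDist ℓ x y = throughDist ℓ y x := by
  rw [throughDist, throughDist, iInf_comm]
  refine iInf_congr fun b => iInf_congr fun a => ?_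
  rw [vertexDist_comm]; ring

theorem throughDist_le_segmentDist_add (x y z : Point G ℓ) :
    throughDist ℓ x z ≤ segmentDist ℓ x y + throughDist ℓ y z := by
  conv_rhs => rw [throughDist]
  simp only [ENNReal.add_iInf]
  refine le_iInf₂ fun a b => le_trans (iInf₂_le a b) ?_
  rw [← add_assoc, ← add_assoc]
  gcongr
  exact toVertex_le_segmentDist_add ℓ x y a

theorem throughDist_triangle (x y z : Point G ℓ) :
    throughDist ℓ x z ≤ throughDist ℓ x y + throughDist ℓ y z := by
  conv_rhs => rw [throughDist, throughDist]
  simp only [ENNReal.iInf_add, ENNReal.add_iInf]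
  refine le_iInf fun c => le_iInf fun d => le_iInf fun a => le_iInf fun b => ?_
  refine le_trans (iInf₂_le a d) ?_
  calc toVertex ℓ x a + vertexDist ℓ a d + toVertex ℓ z d
      ≤ toVertex ℓ x a + (vertexDist ℓ a b + (toVertex ℓ y b + toVertex ℓ y c) +
          vertexDist ℓ c d) + toVertex ℓ z d := by
        gcongr
        refine (vertexDist_triangle ℓ a c d).trans ?_
        gcongr
        refine (vertexDist_triangle ℓ a b c).trans ?_
        gcongr
        exact vertexDist_le_toVertex_add ℓ y b c
    _ = _ := by ring

/-- The (possibly infinite) pseudometric `d_ℓ` on the 1-complex `G`. -/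
noncomputable instance : PseudoEMetricSpace (Point G ℓ) where
  edist := pointDist ℓ
  edist_self x := by
    refine le_antisymm ?_ (zero_le)
    cases x with
    | vertex v =>
      exact (min_le_right _ _).trans ((iInf₂_le v v).trans (by simp [toVertex, vertexDist_self]))
    | inner e t h₀ h₁ => exact (min_le_left _ _).trans (by simp [segmentDist])
  edist_comm x y := by
    rw [pointDist, pointDist, segmentDist_comm, throughDist_comm]
  edist_triangle x y z := by
    simp only [pointDist, min_add, add_min, le_min_iff]
    refine ⟨⟨(min_le_left _ _).trans (segmentDist_triangle ℓ x y z), ?_⟩, ?_, ?_⟩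
    · rw [throughDist_comm ℓ x z, throughDist_comm ℓ x y, segmentDist_comm ℓ y z, add_comm]
      exact (min_le_right _ _).trans (throughDist_le_segmentDist_add ℓ z y x)
    · exact (min_le_right _ _).trans (throughDist_le_segmentDist_add ℓ x y z)
    · exact (min_le_right _ _).trans (throughDist_triangle ℓ x y z)

/-- The space `|G|_ℓ`: the completion of the 1-complex `G` with respect to `d_ℓ`, points at
distance `0` being identified. -/
abbrev Space (G : SimpleGraph V) (ℓ : G.edgeSet → ℝ) : Type _ := MetricCompletion (Point G ℓ)

/-- The point of the closed edge `e` that corresponds to `t ∈ [0, ℓ e]`. -/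
noncomputable def edgePoint (e : G.edgeSet) (t : Icc 0 (ℓ e)) : Point G ℓ :=
  if h₀ : 0 < (t : ℝ) then
    if h₁ : (t : ℝ) < ℓ e then .inner e t h₀ h₁ else .vertex (tgt e)
  else .vertex (src e)

/-- `E(X)`: the set of edges contained in `X ⊆ |G|_ℓ`. -/
def edgesIn (X : Set (Space G ℓ)) : Set G.edgeSet :=
  {e | ∀ t : Icc 0 (ℓ e), MetricCompletion.of (edgePoint ℓ e t) ∈ X}

/-- The part of the edge `e`, as a subset of `[0, ℓ e]`, that lies in `X ⊆ |G|_ℓ`. -/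
def edgeTrace (X : Set (Space G ℓ)) (e : G.edgeSet) : Set ℝ :=
  {t | ∃ h : t ∈ Icc 0 (ℓ e), MetricCompletion.of (edgePoint ℓ e ⟨t, h⟩) ∈ X}

/-- The set of maximal half-edges contained in `X ⊆ |G|_ℓ`: the pairs of an edge `e` and a maximal
connected subset `J` of the part of `e` that lies in `X`. (The one-point connected sets have
length `0`.) -/
def maxHalfEdgesIn (X : Set (Space G ℓ)) : Set (G.edgeSet × Set ℝ) :=
  {p | Maximal (fun J : Set ℝ => IsConnected J ∧ J ⊆ edgeTrace ℓ X p.1) p.2}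

/-- The length of a half-edge, the length of the corresponding subinterval of `[0, ℓ e]`. -/
noncomputable def halfEdgeLength (p : G.edgeSet × Set ℝ) : ℝ≥0∞ := MeasureTheory.volume p.2

/-- `x` is an inner point of an edge. -/
def IsInnerPoint (x : Space G ℓ) : Prop :=
  ∃ (e : G.edgeSet) (t : ℝ) (h₀ : 0 < t) (h₁ : t < ℓ e),
    x = MetricCompletion.of (Point.inner e t h₀ h₁)

end LengthGraph

/-!
A continuous curve that is injective except possibly at its ends has as its length the
one-dimensional Hausdorff measure of its image, whatever the parametrization; so the lengths in
question are values `μH[1] C`.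

The points of `|G|_ℓ` that are not inner points of edges contribute nothing. In one component of
`G` they lie in the closure of the vertex set, and deleting a finite set `F` of edges leaves only
finitely many components there, whose diameters sum to at most `∑ e ∉ F, ℓ e`, which is arbitrarily
small. As each edge is mapped isometrically on each of its halves, `μH[1] C` is the sum over the
edges `e` of the measure of the trace of `C` on `e`.

A point that is passed by an injective curve in `C` and is an inner point of an edge is interior to
the trace of `C` on that edge, by the intermediate value theorem. On a circle, or on an arc without
endpoints inside edges, this makes the trace clopen in the open edge, hence all or nothing; on an
arbitrary arc the endpoints are the only exceptions, so up to a null set the trace is a union of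
half-edges.
-/

/-! ### Length as Hausdorff measure -/

section HausdorffLength

open MeasureTheory Measure Function

variable {α X Y : Type*} [EMetricSpace X] [MeasurableSpace X] [BorelSpace X]
  [EMetricSpace Y] [MeasurableSpace Y] [BorelSpace Y]

theorem hausdorffMeasure_image_le_of_edist_le {f : α → X} {g : α → Y} {s : Set α}
    (h : ∀ x ∈ s, ∀ y ∈ s, edist (f x) (f y) ≤ edist (g x) (g y)) {d : ℝ} (hd : 0 ≤ d) :
    μH[d] (f '' s) ≤ μH[d] (g '' s) := by
  obtain rfl | ⟨a, -⟩ := s.eq_empty_or_nonempty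
  · simp
  have : Nonempty α := ⟨a⟩
  choose! k hks hgk using fun y (hy : y ∈ g '' s) => hy
  have hfk : f '' s = (f ∘ k) '' (g '' s) := by
    rw [image_image]
    refine image_congr fun x hx => edist_le_zero.1 ((h x hx _ (hks _ ⟨x, hx, rfl⟩)).trans ?_)
    rw [hgk _ ⟨x, hx, rfl⟩, edist_self]
  have hLip : LipschitzOnWith 1 (f ∘ k) (g '' s) := fun y hy z hz => by
    simpa [hgk y hy, hgk z hz] using h (k y) (hks y hy) (k z) (hks z hz)
  simpa [hfk] using hLip.hausdorffMeasure_image_le hd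

theorem hausdorffMeasure_image_of_edist_eq {f : X → Y} {s : Set X}
    (h : ∀ x ∈ s, ∀ y ∈ s, edist (f x) (f y) = edist x y) {d : ℝ} (hd : 0 ≤ d) :
    μH[d] (f '' s) = μH[d] s := by
  refine le_antisymm ?_ ?_
  · simpa using hausdorffMeasure_image_le_of_edist_le (g := id)
      (fun x hx y hy => (h x hx y hy).le) hd
  · simpa using hausdorffMeasure_image_le_of_edist_le (f := id)
      (fun x hx y hy => (h x hx y hy).ge) hd

theorem hausdorffMeasure_image_le_eVariationOn [LinearOrder α] (f : α → X) (s : Set α) :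
    μH[1] (f '' s) ≤ eVariationOn f s := by
  obtain rfl | ⟨a, ha⟩ := s.eq_empty_or_nonempty
  · simp
  by_cases htop : eVariationOn f s = ⊤
  · simp [htop]
  have hloc : LocallyBoundedVariationOn f s := BoundedVariationOn.locallyBoundedVariationOn htop
  set w := variationOnFromTo f s a
  have hw : ∀ x ∈ s, ∀ y ∈ s, x ≤ y →
      edist (w x) (w y) = eVariationOn f (s ∩ Icc x y) := fun x hx y hy hxy => by
    have hadd : w x + variationOnFromTo f s x y = w y := variationOnFromTo.add hloc ha hx hy
    rw [edist_comm, edist_dist, Real.dist_eq, ← hadd, add_sub_cancel_left,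
      variationOnFromTo.eq_of_le f s hxy, abs_of_nonneg ENNReal.toReal_nonneg,
      ENNReal.ofReal_toReal (hloc x y hx hy)]
  have hfw : ∀ x ∈ s, ∀ y ∈ s, edist (f x) (f y) ≤ edist (w x) (w y) := fun x hx y hy => by
    wlog hxy : x ≤ y generalizing x y
    · simpa only [edist_comm] using this y hy x hx (le_of_not_ge hxy)
    rw [hw x hx y hy hxy]
    exact eVariationOn.edist_le f ⟨hx, left_mem_Icc.2 hxy⟩ ⟨hy, right_mem_Icc.2 hxy⟩
  calc μH[1] (f '' s)
      ≤ μH[1] (w '' s) := hausdorffMeasure_image_le_of_edist_le hfw zero_le_one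
    _ = volume (w '' s) := by rw [hausdorffMeasure_real]
    _ ≤ Metric.ediam (w '' s) := Real.volume_le_diam _
    _ ≤ eVariationOn f s := Metric.ediam_image_le_iff.2 fun x hx y hy => by
        wlog hxy : x ≤ y generalizing x y
        · simpa only [edist_comm] using this y hy x hx (le_of_not_ge hxy)
        rw [hw x hx y hy hxy]
        exact eVariationOn.mono f inter_subset_left

theorem lipschitzWith_toReal_min_edist {Z : Type*} [PseudoEMetricSpace Z] (x : Z) {M : ℝ≥0∞}
    (hM : M ≠ ⊤) : LipschitzWith 1 fun y => (min (edist x y) M).toReal := by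
  have hfin : ∀ y, min (edist x y) M ≠ ⊤ := fun y => ne_top_of_le_ne_top hM (min_le_right _ _)
  refine LipschitzWith.of_edist_le fun y z => ?_
  wlog hyz : (min (edist x y) M).toReal ≤ (min (edist x z) M).toReal generalizing y z
  · simpa only [edist_comm] using this z y (le_of_not_ge hyz)
  rw [edist_comm, edist_dist, Real.dist_eq, abs_of_nonneg (sub_nonneg.2 hyz),
    ENNReal.ofReal_sub _ ENNReal.toReal_nonneg, ENNReal.ofReal_toReal (hfin z),
    ENNReal.ofReal_toReal (hfin y), tsub_le_iff_left, min_add]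
  refine le_min ((min_le_left _ _).trans (edist_triangle x y z)) ?_
  exact (min_le_right _ _).trans le_self_add

theorem edist_le_hausdorffMeasure_of_isPreconnected {K : Set X} (hK : IsPreconnected K) {x y : X}
    (hx : x ∈ K) (hy : y ∈ K) : edist x y ≤ μH[1] K := by
  refine le_of_forall_lt fun M hM => ?_
  obtain ⟨N, hMN, hN⟩ := exists_between hM
  refine hMN.trans_le ?_
  have hNtop : N ≠ ⊤ := hN.ne_top
  have hLip := lipschitzWith_toReal_min_edist x hNtop
  set g : X → ℝ := fun z => (min (edist x z) N).toReal
  have hgx : g x = 0 := by simp [g]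
  have hgy : g y = N.toReal := by simp [g, hN.le]
  have hIcc : Icc 0 N.toReal ⊆ g '' K := by
    rw [← hgx, ← hgy]
    exact hK.intermediate_value hx hy hLip.continuous.continuousOn
  calc N = volume (Icc 0 N.toReal) := by simp [hNtop]
    _ ≤ volume (g '' K) := measure_mono hIcc
    _ = μH[1] (g '' K) := by rw [hausdorffMeasure_real]
    _ ≤ μH[1] K := by simpa using hLip.hausdorffMeasure_image_le zero_le_one K

theorem aedisjoint_image_Icc [LinearOrder α] {f : α → X} {a b p q r s : α}
    (hf : InjOn f (Ioo a b)) (hap : a ≤ p) (hqr : q ≤ r) (hsb : s ≤ b) :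
    AEDisjoint μH[1] (f '' Icc p q) (f '' Icc r s) := by
  have := nullSingletonClass_hausdorff X one_pos
  refine measure_mono_null (t := {f a, f b, f q}) ?_ ((Set.toFinite _).countable.measure_zero _)
  rintro _ ⟨⟨u, hu, rfl⟩, v, hv, hvu⟩
  by_contra! hne
  simp only [mem_insert_iff, mem_singleton_iff, not_or] at hne
  obtain ⟨hua, hub, huq⟩ := hne
  have huv : u ≤ v := hu.2.trans (hqr.trans hv.1)
  have hau : a < u := (hap.trans hu.1).lt_of_ne (by rintro rfl; exact hua rfl)
  have hvb : v < b := (hv.2.trans hsb).lt_of_ne (by rintro rfl; exact hub hvu.symm)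
  have heq : v = u := hf ⟨hau.trans_le huv, hvb⟩ ⟨hau, huv.trans_lt hvb⟩ hvu
  exact huq (congrArg f (hu.2.antisymm (hqr.trans (hv.1.trans heq.le))))

theorem eVariationOn_Icc_eq_hausdorffMeasure [ConditionallyCompleteLinearOrder α]
    [TopologicalSpace α] [OrderTopology α] [DenselyOrdered α] {f : α → X} {a b : α}
    (hf : ContinuousOn f (Icc a b)) (hinj : InjOn f (Ioo a b)) :
    eVariationOn f (Icc a b) = μH[1] (f '' Icc a b) := by
  refine le_antisymm (iSup_le ?_) (hausdorffMeasure_image_le_eVariationOn f _)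
  rintro ⟨n, u, hu, hmem⟩
  have hsub : ∀ i, Icc (u i) (u (i + 1)) ⊆ Icc a b :=
    fun i => Icc_subset_Icc (hmem i).1 (hmem (i + 1)).2
  have hmeas : ∀ i, MeasurableSet (f '' Icc (u i) (u (i + 1))) :=
    fun i => (isCompact_Icc.image_of_continuousOn (hf.mono (hsub i))).measurableSet
  have hdisj : Pairwise (AEDisjoint μH[1] on fun i => f '' Icc (u i) (u (i + 1))) := by
    intro i j hij
    wlog hlt : i < j generalizing i j
    · exact (this hij.symm (hij.lt_or_gt.resolve_left hlt)).symm
    exact aedisjoint_image_Icc hinj (hmem i).1 (hu hlt) (hmem (j + 1)).2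
  calc ∑ i ∈ Finset.range n, edist (f (u (i + 1))) (f (u i))
      ≤ ∑ i ∈ Finset.range n, μH[1] (f '' Icc (u i) (u (i + 1))) := by
        refine Finset.sum_le_sum fun i _ => ?_
        have hle : u i ≤ u (i + 1) := hu i.le_succ
        exact edist_le_hausdorffMeasure_of_isPreconnected
          (isPreconnected_Icc.image f (hf.mono (hsub i)))
          (mem_image_of_mem f (right_mem_Icc.2 hle)) (mem_image_of_mem f (left_mem_Icc.2 hle))
    _ = μH[1] (⋃ i ∈ Finset.range n, f '' Icc (u i) (u (i + 1))) :=
        (measure_biUnion_finset₀ (fun i _ j _ hij => hdisj hij) fun i _ =>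
          (hmeas i).nullMeasurableSet).symm
    _ ≤ μH[1] (f '' Icc a b) :=
        measure_mono (iUnion₂_subset fun i _ => image_mono (hsub i))

theorem IsParametrization.pathLength_eq_hausdorffMeasure {C : Set X} {γ : unitInterval → X}
    (hγ : IsParametrization C γ) : pathLength γ = μH[1] C := by
  have h := eVariationOn_Icc_eq_hausdorffMeasure hγ.continuous.continuousOn hγ.injOn
  have huniv : Icc (0 : unitInterval) 1 = univ := Icc_bot_top
  rwa [huniv, image_univ, hγ.range_eq] at h

theorem IsParametrization.hasLength {C : Set X} {γ : unitInterval → X}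
    (hγ : IsParametrization C γ) : HasLength C (μH[1] C) :=
  ⟨⟨γ, hγ⟩, fun _ hδ => hδ.pathLength_eq_hausdorffMeasure⟩

end HausdorffLength

/-! ### Curves through points of circles and arcs -/

section Parametrizations

variable {X : Type*} [TopologicalSpace X] {C : Set X}

theorem isCircle_iff_nonempty_homeomorph_unitAddCircle :
    IsCircle C ↔ Nonempty (UnitAddCircle ≃ₜ C) :=
  let e := AddCircle.homeomorphCircle (one_ne_zero (α := ℝ))
  ⟨fun ⟨h⟩ => ⟨e.trans h⟩, fun ⟨h⟩ => ⟨e.symm.trans h⟩⟩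

theorem isParametrization_of_homeomorph_unitInterval (h : unitInterval ≃ₜ C) :
    IsParametrization C fun t => (h t : X) where
  continuous := by fun_prop
  range_eq := by
    rw [range_comp' Subtype.val h, h.surjective.range_eq, image_univ, Subtype.range_coe]
  injOn := (Subtype.coe_injective.comp h.injective).injOn

theorem isParametrization_of_homeomorph_unitAddCircle (h : UnitAddCircle ≃ₜ C) :
    IsParametrization C fun t : unitInterval => (h (t : ℝ) : X) where
  continuous := continuous_subtype_val.comp
    (h.continuous.comp ((AddCircle.continuous_mk' 1).comp continuous_subtype_val))
  range_eq := by
    have hsurj : ((↑) : ℝ → UnitAddCircle) '' unitInterval = univ := by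
      simpa only [zero_add] using AddCircle.coe_image_Icc_eq (1 : ℝ) 0
    rw [range_comp' (fun x : ℝ => (h x : X)) Subtype.val, Subtype.range_coe,
      ← image_image (fun w => (h w : X)), hsurj, image_univ, range_comp' Subtype.val h,
      h.surjective.range_eq, image_univ, Subtype.range_coe]
  injOn := by
    have hIco : ∀ t ∈ Ioo (0 : unitInterval) 1, (t : ℝ) ∈ Ico (0 : ℝ) (0 + 1) := fun t ht =>
      ⟨t.2.1, by simpa using Subtype.coe_lt_coe.2 ht.2⟩
    intro s hs t ht hst
    exact Subtype.ext ((AddCircle.coe_eq_coe_iff_of_mem_Ico (hIco s hs) (hIco t ht)).1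
      (h.injective (Subtype.ext hst)))

theorem IsParametrization.isClosed [T2Space X] {γ : unitInterval → X}
    (hγ : IsParametrization C γ) : IsClosed C :=
  hγ.range_eq ▸ (isCompact_range hγ.continuous).isClosed

theorem IsParametrization.isPreconnected {γ : unitInterval → X} (hγ : IsParametrization C γ) :
    IsPreconnected C :=
  hγ.range_eq ▸ isPreconnected_range hγ.continuous

theorem IsCircle.exists_isParametrization (hC : IsCircle C) : ∃ γ, IsParametrization C γ :=
  let ⟨h⟩ := isCircle_iff_nonempty_homeomorph_unitAddCircle.1 hC
  ⟨_, isParametrization_of_homeomorph_unitAddCircle h⟩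

theorem IsArc.exists_isParametrization (hC : IsArc C) : ∃ γ, IsParametrization C γ :=
  let ⟨h⟩ := hC
  ⟨_, isParametrization_of_homeomorph_unitInterval h⟩

/-- `C` contains a curve that passes injectively through `x`: every point of a circle is of this
kind, and every point of an arc except its endpoints. -/
def IsTraversedAt (C : Set X) (x : X) : Prop :=
  ∃ (g : ℝ → X) (c : ℝ), ∃ s ∈ 𝓝 c, ContinuousOn g s ∧ InjOn g s ∧ MapsTo g s C ∧ g c = x

theorem IsCircle.isTraversedAt (hC : IsCircle C) {x : X} (hx : x ∈ C) : IsTraversedAt C x := by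
  obtain ⟨h⟩ := isCircle_iff_nonempty_homeomorph_unitAddCircle.1 hC
  obtain ⟨w, hw⟩ := h.surjective ⟨x, hx⟩
  obtain ⟨c, rfl⟩ := QuotientAddGroup.mk_surjective w
  obtain ⟨φ, hcφ, hφ⟩ := AddCircle.isLocalHomeomorph_coe (1 : ℝ) c
  have hφ' : (QuotientAddGroup.mk : ℝ → UnitAddCircle) = φ := hφ
  refine ⟨fun y => h (φ y), c, φ.source, φ.open_source.mem_nhds hcφ, ?_, ?_, ?_, ?_⟩
  · exact (continuous_subtype_val.comp h.continuous).comp_continuousOn φ.continuousOn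
  · exact (Subtype.coe_injective.comp h.injective).comp_injOn φ.injOn
  · exact fun y _ => Subtype.coe_prop _
  · change (h (φ c) : X) = x
    rw [← hφ', hw]

theorem isTraversedAt_of_homeomorph_unitInterval (h : unitInterval ≃ₜ C) {t : unitInterval}
    (ht : t ∈ Ioo 0 1) : IsTraversedAt C (h t) := by
  refine ⟨fun y => h (projIcc 0 1 zero_le_one y), t, Ioo 0 1, Ioo_mem_nhds ht.1 ht.2,
    Continuous.continuousOn (by fun_prop), ?_, fun y _ => Subtype.coe_prop _, by simp⟩
  exact (Subtype.coe_injective.comp h.injective).comp_injOn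
    ((strictMonoOn_projIcc zero_le_one).injOn.mono Ioo_subset_Icc_self)

theorem eq_or_eq_of_not_isTraversedAt (h : unitInterval ≃ₜ C) {x : X} (hx : x ∈ C)
    (hnot : ¬ IsTraversedAt C x) : x = h 0 ∨ x = h 1 := by
  obtain ⟨t, ht⟩ := h.surjective ⟨x, hx⟩
  obtain rfl : (h t : X) = x := congrArg Subtype.val ht
  by_contra! hne
  have h₀ : t ≠ 0 := fun h0 => hne.1 (h0 ▸ rfl)
  have h₁ : t ≠ 1 := fun h1 => hne.2 (h1 ▸ rfl)
  exact hnot (isTraversedAt_of_homeomorph_unitInterval h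
    ⟨unitInterval.pos_iff_ne_zero.2 h₀, unitInterval.lt_one_iff_ne_one.2 h₁⟩)

theorem IsArc.isTraversedAt (hC : IsArc C) {x : X} (hx : x ∈ C) (hend : ¬ IsEndpoint C x) :
    IsTraversedAt C x :=
  let ⟨h⟩ := hC
  by_contra fun hnot => hend ⟨h, (eq_or_eq_of_not_isTraversedAt h hx hnot).imp .symm .symm⟩

theorem IsArc.finite_not_isTraversedAt (hC : IsArc C) : {x ∈ C | ¬ IsTraversedAt C x}.Finite :=
  let ⟨h⟩ := hC
  (toFinite {(h 0 : X), (h 1 : X)}).subset fun _ hx => eq_or_eq_of_not_isTraversedAt h hx.1 hx.2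

end Parametrizations

section RealLine

open MeasureTheory

theorem image_mem_nhds_of_continuousOn_of_injOn {k : ℝ → ℝ} {s : Set ℝ} {c : ℝ} (hs : s ∈ 𝓝 c)
    (hk : ContinuousOn k s) (hinj : InjOn k s) : k '' s ∈ 𝓝 (k c) := by
  obtain ⟨ε, hε, hball⟩ := Metric.nhds_basis_closedBall.mem_iff.1 hs
  rw [Real.closedBall_eq_Icc] at hball
  refine mem_of_superset ?_ (image_mono hball)
  have hk' := hk.mono hball
  have hp : c - ε < c := by linarith
  have hq : c < c + ε := by linarith
  have hpq : c - ε ≤ c + ε := (hp.trans hq).le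
  have hc : c ∈ Icc (c - ε) (c + ε) := ⟨hp.le, hq.le⟩
  rcases hk'.strictMonoOn_of_injOn_Icc' hpq (hinj.mono hball) with hm | hm
  · exact mem_of_superset (Icc_mem_nhds (hm (left_mem_Icc.2 hpq) hc hp)
      (hm hc (right_mem_Icc.2 hpq) hq)) (intermediate_value_Icc hpq hk')
  · exact mem_of_superset (Icc_mem_nhds (hm hc (right_mem_Icc.2 hpq) hq)
      (hm (left_mem_Icc.2 hpq) hc hp)) (intermediate_value_Icc' hpq hk')

/-- The connected components of `T`, as maximal nonempty connected subsets: the half-edges of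
`LengthGraph.maxHalfEdgesIn` are of this kind. -/
def maximalConnected (T : Set ℝ) : Set (Set ℝ) := {J | Maximal (fun J => IsConnected J ∧ J ⊆ T) J}

theorem mem_maximalConnected {T J : Set ℝ} :
    J ∈ maximalConnected T ↔ Maximal (fun J => IsConnected J ∧ J ⊆ T) J := Iff.rfl

theorem connectedComponentIn_mem_maximalConnected {T : Set ℝ} {t : ℝ} (ht : t ∈ T) :
    connectedComponentIn T t ∈ maximalConnected T :=
  ⟨⟨isConnected_connectedComponentIn_iff.2 ht, connectedComponentIn_subset T t⟩,
    fun _ hJ hle => hJ.1.isPreconnected.subset_connectedComponentIn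
      (hle (mem_connectedComponentIn ht)) hJ.2⟩

theorem pairwiseDisjoint_maximalConnected (T : Set ℝ) :
    (maximalConnected T).PairwiseDisjoint id := fun J hJ K hK hne => by
  rw [mem_maximalConnected] at hJ hK
  refine not_not.1 fun hd => hne ?_
  have hJK : IsConnected (J ∪ K) ∧ J ∪ K ⊆ T :=
    ⟨.union (not_disjoint_iff_nonempty_inter.1 hd) hJ.prop.1 hK.prop.1,
      union_subset hJ.prop.2 hK.prop.2⟩
  exact (hJ.eq_of_subset hJK subset_union_left).trans
    (hK.eq_of_subset hJK subset_union_right).symm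

theorem exists_countable_maximalConnected_cover_interior (T : Set ℝ) :
    ∃ Q ⊆ maximalConnected T, Q.Countable ∧ interior T ⊆ ⋃₀ Q := by
  refine ⟨(fun q : ℚ => connectedComponentIn T q) '' {q | (q : ℝ) ∈ T}, ?_,
    (to_countable _).image _, fun t ht => ?_⟩
  · rintro _ ⟨q, hq, rfl⟩
    exact connectedComponentIn_mem_maximalConnected hq
  · obtain ⟨ε, hε, hball⟩ := Metric.mem_nhds_iff.1 (mem_interior_iff_mem_nhds.1 ht)
    obtain ⟨q, hq⟩ := Rat.denseRange_cast.exists_dist_lt t hε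
    have hqt : (q : ℝ) ∈ Metric.ball t ε := Metric.mem_ball'.2 hq
    exact ⟨_, ⟨q, hball hqt, rfl⟩, (convex_ball t ε).isPreconnected.subset_connectedComponentIn
      hqt hball (Metric.mem_ball_self hε)⟩

theorem tsum_measure_maximalConnected {μ : Measure ℝ} {T : Set ℝ} (hT : μ (T \ interior T) = 0) :
    ∑' J : maximalConnected T, μ J = μ T := by
  have hmax : ∀ J : maximalConnected T, IsConnected (J : Set ℝ) ∧ (J : Set ℝ) ⊆ T :=
    fun J => (mem_maximalConnected.1 J.2).prop
  refine le_antisymm ?_ ?_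
  · exact (tsum_meas_le_meas_iUnion_of_disjoint μ
      (fun J => (hmax J).1.isPreconnected.ordConnected.measurableSet)
      ((pairwiseDisjoint_maximalConnected T).subtype _ _)).trans
      (measure_mono (iUnion_subset fun J => (hmax J).2))
  · obtain ⟨Q, hQT, hQ, hcover⟩ := exists_countable_maximalConnected_cover_interior T
    calc μ T ≤ μ (T ∩ interior T) + μ (T \ interior T) := measure_le_inter_add_sdiff μ T _
      _ ≤ μ (⋃ J ∈ Q, J) := by
        rw [hT, add_zero, ← sUnion_eq_biUnion]
        exact measure_mono (inter_subset_right.trans hcover)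
      _ ≤ ∑' J : Q, μ J := measure_biUnion_le μ hQ _
      _ ≤ ∑' J : maximalConnected T, μ J := ENNReal.tsum_mono_subtype (fun J => μ J) hQT

end RealLine

/-! ### Edges as open subsets of `|G|_ℓ` -/

noncomputable instance (X : Type*) [PseudoEMetricSpace X] : MeasurableSpace (MetricCompletion X) :=
  borel _

instance (X : Type*) [PseudoEMetricSpace X] : BorelSpace (MetricCompletion X) := ⟨rfl⟩

namespace LengthGraph

variable {V : Type*} {G : SimpleGraph V} {ℓ : G.edgeSet → ℝ} {e f : G.edgeSet} {s t : ℝ}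

section Edges

theorem edist_of_of (x y : Point G ℓ) :
    edist (MetricCompletion.of x) (MetricCompletion.of y) =
      min (segmentDist ℓ x y) (throughDist ℓ x y) :=
  MetricCompletion.isometry_of.edist_eq x y

theorem edist_of_le_through (x y : Point G ℓ) (a b : V) :
    edist (MetricCompletion.of x) (MetricCompletion.of y) ≤
      toVertex ℓ x a + vertexDist ℓ a b + toVertex ℓ y b :=
  (edist_of_of x y).trans_le ((min_le_right _ _).trans ((iInf_le _ a).trans (iInf_le _ b)))

theorem edist_of_vertex (u v : V) :
    edist (MetricCompletion.of (.vertex u : Point G ℓ)) (MetricCompletion.of (.vertex v)) =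
      vertexDist ℓ u v := by
  refine le_antisymm ((edist_of_le_through _ _ u v).trans (by simp [toVertex])) ?_
  rw [edist_of_of]
  refine le_min (by simp [segmentDist]) (le_iInf₂ fun a b => ?_)
  simp only [toVertex]
  split_ifs with hau hbv <;> simp [*]

/-- `edgePoint` with a coordinate from the whole line: `t ≤ 0` gives `src e`, and `t ≥ ℓ e` gives
`tgt e`. -/
noncomputable def pointAt (ℓ : G.edgeSet → ℝ) (e : G.edgeSet) (t : ℝ) : Point G ℓ :=
  if h₀ : 0 < t then
    if h₁ : t < ℓ e then .inner e t h₀ h₁ else .vertex (tgt e)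
  else .vertex (src e)

theorem pointAt_of_mem_Ioo (ht : t ∈ Ioo 0 (ℓ e)) : pointAt ℓ e t = .inner e t ht.1 ht.2 := by
  simp [pointAt, ht.1, ht.2]

/-- The edge `e` as a curve in `|G|_ℓ`. -/
noncomputable def edgeMap (ℓ : G.edgeSet → ℝ) (e : G.edgeSet) (t : ℝ) : Space G ℓ :=
  MetricCompletion.of (pointAt ℓ e t)

/-- The set of inner points of the edge `e`. -/
def openEdge (ℓ : G.edgeSet → ℝ) (e : G.edgeSet) : Set (Space G ℓ) := edgeMap ℓ e '' Ioo 0 (ℓ e)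

theorem isInnerPoint_iff {z : Space G ℓ} : IsInnerPoint ℓ z ↔ ∃ e, z ∈ openEdge ℓ e := by
  constructor
  · rintro ⟨e, t, h₀, h₁, rfl⟩
    exact ⟨e, t, ⟨h₀, h₁⟩, by rw [edgeMap, pointAt_of_mem_Ioo ⟨h₀, h₁⟩]⟩
  · rintro ⟨e, t, ht, rfl⟩
    exact ⟨e, t, ht.1, ht.2, by rw [edgeMap, pointAt_of_mem_Ioo ht]⟩

theorem edgeTrace_eq (X : Set (Space G ℓ)) (e : G.edgeSet) :
    edgeTrace ℓ X e = Icc 0 (ℓ e) ∩ edgeMap ℓ e ⁻¹' X :=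
  ext fun _ => ⟨fun ⟨h, hX⟩ => ⟨h, hX⟩, fun ⟨h, hX⟩ => ⟨h, hX⟩⟩

theorem edgesIn_eq (X : Set (Space G ℓ)) :
    edgesIn ℓ X = {e | Icc 0 (ℓ e) ⊆ edgeTrace ℓ X e} :=
  ext fun _ => ⟨fun h t ht => ⟨ht, h ⟨t, ht⟩⟩, fun h t => (h t.2).2⟩

theorem lipschitzOnWith_edgeMap (e : G.edgeSet) :
    LipschitzOnWith 1 (edgeMap ℓ e) (Icc 0 (ℓ e)) := by
  intro s hs t ht
  rw [ENNReal.coe_one, one_mul]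
  wlog hst : s < t generalizing s t
  · rcases (not_lt.1 hst).eq_or_lt with rfl | hts
    · simp
    · simpa only [edist_comm] using this ht hs hts
  have hs' : s < ℓ e := hst.trans_le ht.2
  have ht' : 0 < t := hs.1.trans_lt hst
  rw [edist_comm s, edist_dist t, Real.dist_eq, abs_of_pos (sub_pos.2 hst)]
  rcases hs.1.eq_or_lt with rfl | hs₀ <;> rcases ht.2.eq_or_lt with rfl | ht₁
  · refine (edist_of_le_through _ _ (src e) (tgt e)).trans ?_
    simpa [pointAt, toVertex, ht'] using vertexDist_src_tgt ℓ e
  · refine (edist_of_le_through _ _ (src e) (src e)).trans ?_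
    simp [pointAt, toVertex, ht', ht₁, vertexDist_self]
  · refine (edist_of_le_through _ _ (tgt e) (tgt e)).trans ?_
    simp [pointAt, toVertex, hs₀, hs', ht', vertexDist_self, (adj_src_tgt e).ne']
  · refine (edist_of_of _ _).trans_le ((min_le_left _ _).trans ?_)
    simp [pointAt, segmentDist, hs₀, hs', ht', ht₁, abs_sub_comm s, abs_of_pos (sub_pos.2 hst)]

theorem continuousOn_edgeMap (e : G.edgeSet) : ContinuousOn (edgeMap ℓ e) (Icc 0 (ℓ e)) :=
  (lipschitzOnWith_edgeMap e).continuousOn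

theorem isClosed_edgeTrace {C : Set (Space G ℓ)} (hC : IsClosed C) (e : G.edgeSet) :
    IsClosed (edgeTrace ℓ C e) := by
  rw [edgeTrace_eq]
  exact (continuousOn_edgeMap e).preimage_isClosed_of_isClosed isClosed_Icc hC

/-- The distance of `t ∈ [0, L]` to the ends of the interval. -/
noncomputable def endDist (L t : ℝ) : ℝ := min t (L - t)

theorem endDist_pos_iff {L : ℝ} : 0 < endDist L t ↔ t ∈ Ioo 0 L := by
  simp [endDist]

theorem endDist_le_toVertex (e : G.edgeSet) (t : ℝ) (a : V) :
    ENNReal.ofReal (endDist (ℓ e) t) ≤ toVertex ℓ (pointAt ℓ e t) a := by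
  by_cases ht : t ∈ Ioo 0 (ℓ e)
  · simp only [pointAt_of_mem_Ioo ht, toVertex]
    split_ifs
    · exact ENNReal.ofReal_le_ofReal (min_le_left _ _)
    · exact ENNReal.ofReal_le_ofReal (min_le_right _ _)
    · exact le_top
  · simp [ENNReal.ofReal_eq_zero.2 (not_lt.1 (mt endDist_pos_iff.1 ht))]

theorem min_le_edist_edgeMap (e : G.edgeSet) (s t : ℝ) :
    ENNReal.ofReal (min |s - t| (endDist (ℓ e) s + endDist (ℓ e) t)) ≤
      edist (edgeMap ℓ e s) (edgeMap ℓ e t) := by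
  rw [edgeMap, edgeMap, edist_of_of]
  refine le_min ((ENNReal.ofReal_le_ofReal (min_le_left _ _)).trans ?_)
    ((ENNReal.ofReal_le_ofReal (min_le_right _ _)).trans (le_iInf₂ fun a b => ?_))
  · simp only [pointAt]
    split_ifs <;> simp [segmentDist]
  · refine ENNReal.ofReal_add_le.trans (add_le_add ?_ (endDist_le_toVertex e t b))
    exact (endDist_le_toVertex e s a).trans le_self_add

theorem exists_eq_pointAt_of_edist_lt {x : Point G ℓ}
    (h : edist (edgeMap ℓ e s) (MetricCompletion.of x) < ENNReal.ofReal (endDist (ℓ e) s)) :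
    ∃ t ∈ Ioo 0 (ℓ e), x = pointAt ℓ e t := by
  have hs : s ∈ Ioo 0 (ℓ e) := endDist_pos_iff.1 (ENNReal.ofReal_pos.1 (pos_of_gt h))
  rw [edgeMap, edist_of_of] at h
  have hthrough : ENNReal.ofReal (endDist (ℓ e) s) ≤ throughDist ℓ (pointAt ℓ e s) x :=
    le_iInf₂ fun a _ => (endDist_le_toVertex e s a).trans (le_self_add.trans le_self_add)
  have hsegment := (min_lt_iff.1 h).resolve_right hthrough.not_gt
  rw [pointAt_of_mem_Ioo hs] at hsegment
  cases x with
  | vertex v => simp [segmentDist] at hsegment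
  | inner f t h₀ h₁ =>
    obtain rfl : e = f := by
      by_contra hef
      simp [segmentDist, hef] at hsegment
    exact ⟨t, ⟨h₀, h₁⟩, (pointAt_of_mem_Ioo ⟨h₀, h₁⟩).symm⟩

theorem eball_subset_openEdge (e : G.edgeSet) (s : ℝ) :
    Metric.eball (edgeMap ℓ e s) (ENNReal.ofReal (endDist (ℓ e) s)) ⊆ openEdge ℓ e := by
  have hinner : ∀ x : Point G ℓ, MetricCompletion.of x ∈
      Metric.eball (edgeMap ℓ e s) (ENNReal.ofReal (endDist (ℓ e) s)) →
      MetricCompletion.of x ∈ openEdge ℓ e := fun x hx => by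
    obtain ⟨t, ht, rfl⟩ := exists_eq_pointAt_of_edist_lt (Metric.mem_eball'.1 hx)
    exact mem_image_of_mem _ ht
  have hclosed : IsClosed (edgeMap ℓ e '' Icc 0 (ℓ e)) :=
    (isCompact_Icc.image_of_continuousOn (continuousOn_edgeMap e)).isClosed
  have hsub : Metric.eball (edgeMap ℓ e s) (ENNReal.ofReal (endDist (ℓ e) s)) ⊆
      edgeMap ℓ e '' Icc 0 (ℓ e) := by
    refine (MetricCompletion.denseRange_of.open_subset_closure_inter Metric.isOpen_eball).trans
      (closure_minimal ?_ hclosed)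
    rintro _ ⟨hx, x, rfl⟩
    exact image_mono Ioo_subset_Icc_self (hinner x hx)
  intro z hz
  obtain ⟨t, -, rfl⟩ := hsub hz
  exact hinner _ hz

theorem injOn_edgeMap (e : G.edgeSet) : InjOn (edgeMap ℓ e) (Ioo 0 (ℓ e)) := by
  intro s hs t ht hst
  have h := min_le_edist_edgeMap (ℓ := ℓ) e s t
  rw [hst, edist_self, nonpos_iff_eq_zero, ENNReal.ofReal_eq_zero, min_le_iff] at h
  have hpos := add_pos (endDist_pos_iff.2 hs) (endDist_pos_iff.2 ht)
  exact sub_eq_zero.1 (abs_nonpos_iff.1 (h.resolve_right hpos.not_ge))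

theorem isOpen_edgeMap_image {U : Set ℝ} (hU : IsOpen U) (hUe : U ⊆ Ioo 0 (ℓ e)) :
    IsOpen (edgeMap ℓ e '' U) := by
  rw [EMetric.isOpen_iff]
  rintro _ ⟨s, hs, rfl⟩
  obtain ⟨r, hr, hrU⟩ := Metric.isOpen_iff.1 hU s hs
  refine ⟨ENNReal.ofReal (min r (endDist (ℓ e) s)),
    ENNReal.ofReal_pos.2 (lt_min hr (endDist_pos_iff.2 (hUe hs))), fun z hz => ?_⟩
  obtain ⟨t, ht, rfl⟩ := eball_subset_openEdge e s
    (Metric.eball_subset_eball (ENNReal.ofReal_le_ofReal (min_le_right _ _)) hz)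
  have hlt := (ENNReal.ofReal_lt_ofReal_iff'.1
    ((min_le_edist_edgeMap e s t).trans_lt (Metric.mem_eball'.1 hz))).1
  have hts : |s - t| < r := by
    have := endDist_pos_iff.2 ht
    grind
  exact mem_image_of_mem _ (hrU (by rwa [Metric.mem_ball', Real.dist_eq]))

theorem isOpen_openEdge (e : G.edgeSet) : IsOpen (openEdge ℓ e) :=
  isOpen_edgeMap_image isOpen_Ioo subset_rfl

theorem pairwise_disjoint_openEdge : Pairwise (Function.onFun Disjoint (openEdge ℓ)) := by
  refine fun e f hef => disjoint_left.2 ?_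
  rintro _ ⟨s, hs, rfl⟩ ⟨t, ht, hts⟩
  obtain ⟨r, hr, hrt⟩ := exists_eq_pointAt_of_edist_lt (x := pointAt ℓ f t) (s := s) <| by
    change edist (edgeMap ℓ e s) (edgeMap ℓ f t) < _
    simpa [hts] using endDist_pos_iff.2 hs
  rw [pointAt_of_mem_Ioo ht, pointAt_of_mem_Ioo hr] at hrt
  injection hrt with hfe
  exact hef hfe.symm

/-- The coordinate on the inner points of the edge `e`, as the inverse of a local homeomorphism. -/
noncomputable def edgeChart (ℓ : G.edgeSet → ℝ) (e : G.edgeSet) :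
    OpenPartialHomeomorph ℝ (Space G ℓ) :=
  .ofContinuousOpenRestrict ((injOn_edgeMap e).toPartialEquiv (edgeMap ℓ e) (Ioo 0 (ℓ e)))
    ((continuousOn_edgeMap e).mono Ioo_subset_Icc_self)
    (fun U hU => by
      have hopen := isOpen_edgeMap_image (isOpen_Ioo.isOpenMap_subtype_val U hU)
        (Subtype.coe_image_subset _ U)
      exact image_image (edgeMap ℓ e) Subtype.val U ▸ hopen)
    isOpen_Ioo

end Edges

/-! ### Hausdorff measure on `|G|_ℓ` -/

open MeasureTheory Measure Metric

section OpenEdges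

theorem edist_edgeMap_of_abs_sub_le {s t : ℝ} (hs : s ∈ Icc 0 (ℓ e)) (ht : t ∈ Icc 0 (ℓ e))
    (hst : |s - t| ≤ endDist (ℓ e) s + endDist (ℓ e) t) :
    edist (edgeMap ℓ e s) (edgeMap ℓ e t) = edist s t := by
  refine le_antisymm (by simpa using lipschitzOnWith_edgeMap e hs ht) ?_
  have h := min_le_edist_edgeMap (ℓ := ℓ) e s t
  rwa [min_eq_left hst, ← Real.dist_eq, ← edist_dist] at h

theorem hausdorffMeasure_edgeMap_image {T : Set ℝ} (hT : T ⊆ Ioo 0 (ℓ e)) :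
    μH[1] (edgeMap ℓ e '' T) = volume T := by
  -- The edge is isometric on each of its halves, but possibly not as a whole.
  have hhalf : ∀ S ⊆ T, (∀ s ∈ S, ∀ t ∈ S, |s - t| ≤ endDist (ℓ e) s + endDist (ℓ e) t) →
      μH[1] (edgeMap ℓ e '' S) = volume S := fun S hST hS => by
    rw [← hausdorffMeasure_real]
    exact hausdorffMeasure_image_of_edist_eq (fun s hs t ht => edist_edgeMap_of_abs_sub_le
      (Ioo_subset_Icc_self (hT (hST hs))) (Ioo_subset_Icc_self (hT (hST ht))) (hS s hs t ht))
      zero_le_one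
  set R : Set ℝ := Ioo 0 (ℓ e) ∩ Ioi (ℓ e / 2) with hR
  have hRe : R ⊆ Ioo 0 (ℓ e) := inter_subset_left
  have hRo : IsOpen R := isOpen_Ioo.inter isOpen_Ioi
  have hinj := injOn_edgeMap (ℓ := ℓ) e
  calc μH[1] (edgeMap ℓ e '' T)
      = μH[1] (edgeMap ℓ e '' (T ∩ R)) + μH[1] (edgeMap ℓ e '' (T \ R)) := by
        rw [← measure_inter_add_sdiff _ (isOpen_edgeMap_image hRo hRe).measurableSet,
          hinj.image_inter hT hRe, (hinj.mono hT).image_sdiff, hinj.image_inter hT hRe,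
          sdiff_self_inter]
    _ = volume (T ∩ R) + volume (T \ R) := by
        rw [hhalf _ inter_subset_left, hhalf _ sdiff_subset]
        · rintro s ⟨hs, hsR⟩ t ⟨ht, htR⟩
          have := hT hs
          have := hT ht
          simp only [hR, mem_inter_iff, mem_Ioi, mem_Ioo, endDist] at *
          grind
        · rintro s ⟨-, hsR⟩ t ⟨-, htR⟩
          simp only [hR, mem_inter_iff, mem_Ioi, mem_Ioo, endDist] at *
          grind
    _ = volume T := measure_inter_add_sdiff _ hRo.measurableSet

theorem hausdorffMeasure_inter_openEdge (C : Set (Space G ℓ)) (e : G.edgeSet) :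
    μH[1] (C ∩ openEdge ℓ e) = volume (edgeTrace ℓ C e) := by
  have himage : C ∩ openEdge ℓ e = edgeMap ℓ e '' (edgeMap ℓ e ⁻¹' C ∩ Ioo 0 (ℓ e)) :=
    image_preimage_inter _ _ _ ▸ rfl
  rw [himage, hausdorffMeasure_edgeMap_image inter_subset_right, edgeTrace_eq, inter_comm]
  exact measure_congr (Ioo_ae_eq_Icc.inter (ae_eq_refl _))

end OpenEdges

section Vertices

theorem exists_reachable_deleteEdges {s : Set (Sym2 V)} {S : Set V}
    (hS : ∀ e ∈ s, ∀ v ∈ e, v ∈ S) {u v : V} (hu : u ∈ S) (h : G.Reachable u v) :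
    ∃ b ∈ S, (G.deleteEdges s).Reachable b v := by
  obtain ⟨p⟩ := h.symm
  induction p with
  | nil => exact ⟨_, hu, .rfl⟩
  | @cons v w u hvw p ih =>
    by_cases hs : s(v, w) ∈ s
    · exact ⟨v, hS _ hs v (Sym2.mem_mk_left v w), .rfl⟩
    · obtain ⟨b, hb, hbw⟩ := ih hu p.reverse.reachable
      have hadj : (G.deleteEdges s).Adj w v :=
        (SimpleGraph.deleteEdges_adj.2 ⟨hvw, hs⟩).symm
      exact ⟨b, hb, hbw.trans hadj.reachable⟩

theorem walkLength_le_tsum {u v : V} {p : G.Walk u v} (hp : p.IsTrail) {A : Set G.edgeSet}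
    (hA : ∀ e : G.edgeSet, (e : Sym2 V) ∈ p.edges → e ∈ A) :
    walkLength ℓ p ≤ ∑' e : A, ENNReal.ofReal (ℓ e) := by
  classical
  set L : List G.edgeSet := p.darts.map fun d => ⟨d.edge, d.edge_mem⟩ with hL
  have hLp : L.map (↑) = p.edges := by
    simp [hL, SimpleGraph.Walk.edges, Function.comp_def]
  have hnodup : L.Nodup := .of_map _ (hLp ▸ hp.edges_nodup)
  have hLA : (L.toFinset : Set G.edgeSet) ⊆ A := fun e he =>
    hA e (hLp ▸ List.mem_map_of_mem (List.mem_toFinset.1 he))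
  calc walkLength ℓ p = ∑ e ∈ L.toFinset, ENNReal.ofReal (ℓ e) := by
        rw [List.sum_toFinset _ hnodup, hL, List.map_map]; rfl
    _ = ∑' e : (L.toFinset : Set G.edgeSet), ENNReal.ofReal (ℓ e) :=
        (Finset.tsum_subtype' _ _).symm
    _ ≤ ∑' e : A, ENNReal.ofReal (ℓ e) :=
        ENNReal.tsum_mono_subtype (fun e => ENNReal.ofReal (ℓ e)) hLA

/-- The edges of a component `c` of `G - s`. -/
def edgesOfComponent (s : Set (Sym2 V)) (c : (G.deleteEdges s).ConnectedComponent) :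
    Set G.edgeSet :=
  {e | (e : Sym2 V) ∉ s ∧ (G.deleteEdges s).connectedComponentMk (src e) = c}

theorem vertexDist_le_tsum_edgesOfComponent {s : Set (Sym2 V)}
    {c : (G.deleteEdges s).ConnectedComponent} {u v : V} (hu : u ∈ c.supp) (hv : v ∈ c.supp) :
    vertexDist ℓ u v ≤ ∑' e : edgesOfComponent s c, ENNReal.ofReal (ℓ e) := by
  classical
  obtain ⟨p, hp⟩ := (SimpleGraph.ConnectedComponent.exact (hu.trans hv.symm)).exists_isPath
  have hle := G.deleteEdges_le s
  refine (vertexDist_le_walkLength ℓ (p.mapLe hle)).trans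
    (walkLength_le_tsum ((SimpleGraph.Walk.isTrail_mapLe hle).2 hp.isTrail) fun e he => ?_)
  rw [SimpleGraph.Walk.edges_mapLe_eq_edges] at he
  have hmem := p.edges_subset_edgeSet he
  rw [SimpleGraph.edgeSet_deleteEdges] at hmem
  have hsrc : src e ∈ p.support :=
    p.mem_support_of_mem_edges he (mk_src_tgt e ▸ Sym2.mem_mk_left _ _)
  exact ⟨hmem.2, (SimpleGraph.ConnectedComponent.sound
    (p.takeUntil _ hsrc).reachable.symm).trans hu⟩

/-- The vertices in `S`, as points of `|G|_ℓ`. -/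
def vertexPoints (ℓ : G.edgeSet → ℝ) (S : Set V) : Set (Space G ℓ) :=
  (fun v => MetricCompletion.of (.vertex v)) '' S

theorem ediam_closure_vertexPoints_supp_le (s : Set (Sym2 V))
    (c : (G.deleteEdges s).ConnectedComponent) :
    ediam (closure (vertexPoints ℓ c.supp)) ≤
      ∑' e : edgesOfComponent s c, ENNReal.ofReal (ℓ e) := by
  rw [ediam_closure]
  refine ediam_le ?_
  rintro _ ⟨u, hu, rfl⟩ _ ⟨v, hv, rfl⟩
  exact (edist_of_vertex u v).trans_le (vertexDist_le_tsum_edgesOfComponent hu hv)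

theorem tsum_ediam_closure_vertexPoints_le (F : Finset G.edgeSet)
    (K : Set (G.deleteEdges ((↑) '' (F : Set G.edgeSet))).ConnectedComponent) :
    ∑' c : K, ediam (closure (vertexPoints ℓ c.1.supp)) ≤
      ∑' e : {e // e ∉ F}, ENNReal.ofReal (ℓ e) := by
  have hdisj : K.PairwiseDisjoint (edgesOfComponent _) :=
    fun c _ d _ hcd => disjoint_left.2 fun e hec hed => hcd (hec.2.symm.trans hed.2)
  calc ∑' c : K, ediam (closure (vertexPoints ℓ c.1.supp))
      ≤ ∑' (c : K) (e : edgesOfComponent _ c.1), ENNReal.ofReal (ℓ e) :=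
        ENNReal.tsum_le_tsum fun c => ediam_closure_vertexPoints_supp_le _ c.1
    _ = ∑' e : ⋃ c ∈ K, edgesOfComponent _ c, ENNReal.ofReal (ℓ e) :=
        (ENNReal.tsum_biUnion' (f := fun e => ENNReal.ofReal (ℓ e)) hdisj).symm
    _ ≤ ∑' e : {e | e ∉ F}, ENNReal.ofReal (ℓ e) := by
        refine ENNReal.tsum_mono_subtype (fun e => ENNReal.ofReal (ℓ e))
          (iUnion₂_subset fun c _ e he heF => he.1 (mem_image_of_mem _ heF))

theorem exists_finite_components_cover_reachable (F : Finset G.edgeSet) (v₀ : V) :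
    ∃ K : Set (G.deleteEdges ((↑) '' (F : Set G.edgeSet))).ConnectedComponent,
      K.Finite ∧ {v | G.Reachable v₀ v} ⊆ ⋃ c ∈ K, c.supp := by
  let S : Set V := insert v₀ (src '' (F : Set G.edgeSet) ∪ tgt '' (F : Set G.edgeSet))
  have hS : S.Finite := ((F.finite_toSet.image _).union (F.finite_toSet.image _)).insert _
  refine ⟨SimpleGraph.connectedComponentMk _ '' S, hS.image _, fun v hv => ?_⟩
  have hends : ∀ e ∈ Subtype.val '' (F : Set G.edgeSet), ∀ w ∈ e, w ∈ S := by
    rintro _ ⟨e, he, rfl⟩ w hw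
    rw [← mk_src_tgt, Sym2.mem_iff] at hw
    rcases hw with rfl | rfl
    · exact .inr (.inl (mem_image_of_mem _ he))
    · exact .inr (.inr (mem_image_of_mem _ he))
  obtain ⟨b, hb, hbv⟩ := exists_reachable_deleteEdges hends (mem_insert v₀ _) hv
  exact mem_biUnion (mem_image_of_mem _ hb) (SimpleGraph.ConnectedComponent.sound hbv.symm)

theorem closure_vertexPoints_subset_of_finite {ι : Type*} {K : Set ι} (hK : K.Finite)
    {S : Set V} {T : ι → Set V} (hS : S ⊆ ⋃ c ∈ K, T c) :
    closure (vertexPoints ℓ S) ⊆ ⋃ c : K, closure (vertexPoints ℓ (T c)) := by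
  rw [← biUnion_eq_iUnion K fun c _ => closure (vertexPoints ℓ (T c)), ← hK.closure_biUnion]
  refine closure_mono ((image_mono hS).trans ?_)
  rw [image_iUnion₂]
  rfl

theorem hausdorffMeasure_closure_vertexPoints_reachable
    (hsum : ∑' e, ENNReal.ofReal (ℓ e) ≠ ⊤) (v₀ : V) :
    μH[1] (closure (vertexPoints ℓ {v | G.Reachable v₀ v})) = 0 := by
  choose K hKfin hKcover using fun F => exists_finite_components_cover_reachable (G := G) F v₀
  have hcountable : ∀ F, Countable (K F) := fun F => (hKfin F).countable
  have htail := ENNReal.tendsto_tsum_compl_atTop_zero hsum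
  have hdiam := fun F => tsum_ediam_closure_vertexPoints_le (ℓ := ℓ) F (K F)
  refine le_antisymm ?_ zero_le
  calc μH[1] (closure (vertexPoints ℓ {v | G.Reachable v₀ v}))
      ≤ liminf (fun F => ∑' c : K F, ediam (closure (vertexPoints ℓ c.1.supp)) ^ (1 : ℝ)) atTop :=
        hausdorffMeasure_le_liminf_tsum 1 _ _ htail _
          (.of_forall fun F c => (ENNReal.le_tsum c).trans (hdiam F))
          (.of_forall fun F => closure_vertexPoints_subset_of_finite (hKfin F) (hKcover F))
    _ ≤ liminf (fun F : Finset G.edgeSet => ∑' e : {e // e ∉ F}, ENNReal.ofReal (ℓ e)) atTop :=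
        liminf_le_liminf (.of_forall fun F => by simpa only [ENNReal.rpow_one] using hdiam F)
    _ = 0 := htail.liminf_eq

theorem infEDist_edgeMap_le (e : G.edgeSet) {t : ℝ} (ht : t ∈ Icc 0 (ℓ e)) :
    infEDist (edgeMap ℓ e t) (vertexPoints ℓ univ) ≤ ENNReal.ofReal (ℓ e) := by
  have hsrc : edgeMap ℓ e 0 ∈ vertexPoints ℓ univ := ⟨src e, trivial, by simp [edgeMap, pointAt]⟩
  calc infEDist (edgeMap ℓ e t) (vertexPoints ℓ univ)
      ≤ edist (edgeMap ℓ e t) (edgeMap ℓ e 0) := infEDist_le_edist_of_mem hsrc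
    _ ≤ edist t 0 := by
        simpa using lipschitzOnWith_edgeMap e ht (left_mem_Icc.2 (ht.1.trans ht.2))
    _ ≤ ENNReal.ofReal (ℓ e) := by
        rw [edist_dist, Real.dist_0_eq_abs, abs_of_nonneg ht.1]
        exact ENNReal.ofReal_le_ofReal ht.2

theorem mem_vertexPoints_of_not_isInnerPoint {x : Point G ℓ}
    (hx : ¬ IsInnerPoint ℓ (MetricCompletion.of x)) :
    MetricCompletion.of x ∈ vertexPoints ℓ univ := by
  cases x with
  | vertex v => exact mem_image_of_mem _ (mem_univ v)
  | inner e t h₀ h₁ => exact absurd ⟨e, t, h₀, h₁, rfl⟩ hx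

theorem mem_closure_vertexPoints_of_not_isInnerPoint (hsum : ∑' e, ENNReal.ofReal (ℓ e) ≠ ⊤)
    {z : Space G ℓ} (hz : ¬ IsInnerPoint ℓ z) : z ∈ closure (vertexPoints ℓ univ) := by
  rw [mem_closure_iff_infEDist_zero]
  refine le_antisymm (le_of_forall_gt fun ε hε => ?_) zero_le
  obtain ⟨δ, hδ, hδε⟩ := exists_between hε
  have hfin := ENNReal.finite_const_le_of_tsum_ne_top hsum hδ.ne'
  set long : Set (Space G ℓ) := ⋃ e ∈ {e | δ ≤ ENNReal.ofReal (ℓ e)}, edgeMap ℓ e '' Icc 0 (ℓ e)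
  have hlong : IsClosed long := hfin.isClosed_biUnion fun e _ =>
    (isCompact_Icc.image_of_continuousOn (continuousOn_edgeMap e)).isClosed
  have hnear : IsClosed {y | infEDist y (vertexPoints ℓ univ) ≤ δ} :=
    isClosed_Iic.preimage continuous_infEDist
  have hcover : range MetricCompletion.of ⊆
      long ∪ {y | infEDist y (vertexPoints ℓ univ) ≤ δ} := by
    rintro _ ⟨x, rfl⟩
    by_cases hx : IsInnerPoint ℓ (MetricCompletion.of x)
    · obtain ⟨e, t, ht, hte⟩ := isInnerPoint_iff.1 hx
      have ht' := Ioo_subset_Icc_self ht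
      rw [← hte]
      rcases le_total δ (ENNReal.ofReal (ℓ e)) with he | he
      · exact .inl (mem_biUnion he (mem_image_of_mem _ ht'))
      · exact .inr ((infEDist_edgeMap_le e ht').trans he)
    · exact .inr ((infEDist_zero_of_mem (mem_vertexPoints_of_not_isInnerPoint hx)).trans_le
        zero_le)
  rcases closure_minimal hcover (hlong.union hnear) (MetricCompletion.denseRange_of z) with h | h
  · obtain ⟨e, -, t, -, rfl⟩ := mem_iUnion₂.1 h
    exact (infEDist_zero_of_mem (mem_vertexPoints_of_not_isInnerPoint hz)).trans_lt hε
  · exact h.trans_lt hδε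

theorem reachable_of_edist_lt_top {u v : V}
    (h : edist (MetricCompletion.of (.vertex u : Point G ℓ))
      (MetricCompletion.of (.vertex v)) < ⊤) :
    G.Reachable u v := by
  rw [edist_of_vertex] at h
  by_contra hn
  have : IsEmpty (G.Walk u v) := not_nonempty_iff.1 hn
  simp [vertexDist] at h

theorem exists_mem_eball_vertex (hsum : ∑' e, ENNReal.ofReal (ℓ e) ≠ ⊤) (z : Space G ℓ) :
    ∃ v : V, z ∈ eball (MetricCompletion.of (.vertex v)) ⊤ := by
  have hfin : infEDist z (vertexPoints ℓ univ) < ⊤ := by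
    by_cases hz : IsInnerPoint ℓ z
    · obtain ⟨e, t, ht, rfl⟩ := isInnerPoint_iff.1 hz
      exact (infEDist_edgeMap_le e (Ioo_subset_Icc_self ht)).trans_lt ENNReal.ofReal_lt_top
    · rw [mem_closure_iff_infEDist_zero.1 (mem_closure_vertexPoints_of_not_isInnerPoint hsum hz)]
      exact ENNReal.zero_lt_top
  obtain ⟨_, ⟨v, -, rfl⟩, hv⟩ := infEDist_lt_iff.1 hfin
  exact ⟨v, mem_eball.2 hv⟩

theorem hausdorffMeasure_eball_inter_not_isInnerPoint (hsum : ∑' e, ENNReal.ofReal (ℓ e) ≠ ⊤)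
    (v₀ : V) :
    μH[1] (eball (MetricCompletion.of (.vertex v₀)) ⊤ ∩ {z : Space G ℓ | ¬ IsInnerPoint ℓ z}) =
      0 := by
  set B : Set (Space G ℓ) := eball (MetricCompletion.of (.vertex v₀)) ⊤
  have hB : IsOpen B := isOpen_eball
  have hclosure : {z : Space G ℓ | ¬ IsInnerPoint ℓ z} ⊆ closure (vertexPoints ℓ univ) :=
    fun z hz => mem_closure_vertexPoints_of_not_isInnerPoint hsum hz
  have hreach : B ∩ vertexPoints ℓ univ ⊆ vertexPoints ℓ {v | G.Reachable v₀ v} := by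
    rintro _ ⟨hv, v, -, rfl⟩
    exact mem_image_of_mem _ (reachable_of_edist_lt_top (mem_eball'.1 hv))
  refine measure_mono_null ?_ (hausdorffMeasure_closure_vertexPoints_reachable hsum v₀)
  exact (inter_subset_inter_right B hclosure).trans (hB.inter_closure.trans (closure_mono hreach))

end Vertices

theorem hausdorffMeasure_eq_tsum_volume_edgeTrace [Countable G.edgeSet]
    (hsum : ∑' e, ENNReal.ofReal (ℓ e) ≠ ⊤) {C : Set (Space G ℓ)} (hC : IsPreconnected C) :
    μH[1] C = ∑' e, volume (edgeTrace ℓ C e) := by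
  rcases C.eq_empty_or_nonempty with rfl | ⟨z, hz⟩
  · simp [edgeTrace_eq]
  obtain ⟨v₀, hv₀⟩ := exists_mem_eball_vertex hsum z
  have hball : C ⊆ eball (MetricCompletion.of (.vertex v₀)) ⊤ :=
    hC.subset_isClopen ⟨isClosed_eball_top, isOpen_eball⟩ ⟨z, hz, hv₀⟩
  have hnull : μH[1] (C \ ⋃ e, openEdge ℓ e) = 0 := by
    refine measure_mono_null (fun y hy => mem_inter (hball hy.1) fun hinner => hy.2 ?_)
      (hausdorffMeasure_eball_inter_not_isInnerPoint hsum v₀)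
    exact mem_iUnion.2 (isInnerPoint_iff.1 hinner)
  have hmeas := fun e => (isOpen_openEdge (ℓ := ℓ) e).measurableSet
  calc μH[1] C = μH[1] (C ∩ ⋃ e, openEdge ℓ e) + 0 := by
        rw [← hnull, measure_inter_add_sdiff _ (.iUnion hmeas)]
    _ = ∑' e, volume (edgeTrace ℓ C e) := by
        simp only [add_zero, inter_comm C]
        rw [← Measure.restrict_apply (.iUnion hmeas),
          measure_iUnion pairwise_disjoint_openEdge hmeas]
        simp only [Measure.restrict_apply, hmeas, inter_comm _ C, hausdorffMeasure_inter_openEdge]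

/-! ### Edges and half-edges contained in circles and arcs -/

section Traces

variable {C : Set (Space G ℓ)}

theorem mem_interior_edgeTrace_of_isTraversedAt (ht : t ∈ Ioo 0 (ℓ e))
    (hC : IsTraversedAt C (edgeMap ℓ e t)) : t ∈ interior (edgeTrace ℓ C e) := by
  obtain ⟨g, c, s, hs, hg, hinj, hgC, hgc⟩ := hC
  set φ := edgeChart ℓ e
  have hφ : ∀ y ∈ Ioo 0 (ℓ e), φ.symm (edgeMap ℓ e y) = y := fun y hy => φ.left_inv hy
  have hs' : s ∩ g ⁻¹' openEdge ℓ e ∈ 𝓝 c := inter_mem hs <| (hg.continuousAt hs) <|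
    (isOpen_openEdge e).mem_nhds (hgc ▸ mem_image_of_mem _ ht)
  have himage := image_mem_nhds_of_continuousOn_of_injOn hs'
    (φ.continuousOn_symm.comp (hg.mono inter_subset_left) fun _ hy => hy.2)
    (φ.symm.injOn.comp (hinj.mono inter_subset_left) fun _ hy => hy.2)
  rw [Function.comp_apply, hgc, hφ t ht] at himage
  refine mem_interior_iff_mem_nhds.2 (mem_of_superset himage ?_)
  rintro _ ⟨y, ⟨hys, r, hr, hry⟩, rfl⟩
  rw [Function.comp_apply, ← hry, hφ r hr, edgeTrace_eq]
  exact ⟨Ioo_subset_Icc_self hr, mem_preimage.2 (hry ▸ hgC hys)⟩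

theorem volume_edgeTrace_of_forall_mem_interior (hC : IsClosed C)
    (hint : ∀ t ∈ Ioo 0 (ℓ e), edgeMap ℓ e t ∈ C → t ∈ interior (edgeTrace ℓ C e)) :
    volume (edgeTrace ℓ C e) = (edgesIn ℓ C).indicator (fun e => ENNReal.ofReal (ℓ e)) e := by
  have hIcc : edgeTrace ℓ C e ⊆ Icc 0 (ℓ e) := edgeTrace_eq C e ▸ inter_subset_left
  have hsub : Ioo 0 (ℓ e) ∩ edgeTrace ℓ C e ⊆ interior (edgeTrace ℓ C e) := by
    rintro t ⟨ht, htT⟩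
    rw [edgeTrace_eq] at htT
    exact hint t ht htT.2
  rcases (Ioo 0 (ℓ e) ∩ edgeTrace ℓ C e).eq_empty_or_nonempty with hempty | ⟨t, ht, htT⟩
  · have hnull : volume (edgeTrace ℓ C e) = 0 := by
      refine measure_mono_null (t := Icc 0 (ℓ e) \ Ioo 0 (ℓ e))
        (subset_sdiff.2 ⟨hIcc, (disjoint_iff_inter_eq_empty.2 hempty).symm⟩) ?_
      exact ae_le_set.1 Ioo_ae_eq_Icc.symm.le
    refine hnull.trans (indicator_apply_eq_zero.2 fun he => ?_).symm
    rw [edgesIn_eq] at he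
    simpa only [Real.volume_Icc, sub_zero, hnull, nonpos_iff_eq_zero] using
      measure_mono (μ := volume) he
  -- The trace is relatively open and closed in the connected open edge.
  have hclosed := isClosed_edgeTrace hC e
  have hIoo : Ioo 0 (ℓ e) ⊆ interior (edgeTrace ℓ C e) :=
    isPreconnected_Ioo.subset_of_closure_inter_subset isOpen_interior ⟨t, ht, hsub ⟨ht, htT⟩⟩
      fun y hy => hsub ⟨hy.2, hclosed.closure_interior_subset hy.1⟩
  have heq : edgeTrace ℓ C e = Icc 0 (ℓ e) := by
    refine hIcc.antisymm ?_
    rw [← closure_Ioo (ht.1.trans ht.2).ne]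
    exact closure_minimal (hIoo.trans interior_subset) hclosed
  have he : e ∈ edgesIn ℓ C := edgesIn_eq C ▸ heq.superset
  rw [indicator_of_mem he, heq, Real.volume_Icc, sub_zero]

theorem tsum_volume_edgeTrace_of_isTraversedAt (hC : IsClosed C)
    (hpass : ∀ x ∈ C, IsInnerPoint ℓ x → IsTraversedAt C x) :
    ∑' e, volume (edgeTrace ℓ C e) = ∑' e : edgesIn ℓ C, ENNReal.ofReal (ℓ e) := by
  rw [tsum_subtype (edgesIn ℓ C) fun e => ENNReal.ofReal (ℓ e)]
  refine tsum_congr fun e => volume_edgeTrace_of_forall_mem_interior hC fun t ht htC => ?_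
  exact mem_interior_edgeTrace_of_isTraversedAt ht
    (hpass _ htC (isInnerPoint_iff.2 ⟨e, mem_image_of_mem _ ht⟩))

theorem volume_edgeTrace_sdiff_interior (hC : {x ∈ C | ¬ IsTraversedAt C x}.Countable)
    (e : G.edgeSet) : volume (edgeTrace ℓ C e \ interior (edgeTrace ℓ C e)) = 0 := by
  have hcount : (Ioo 0 (ℓ e) ∩ edgeMap ℓ e ⁻¹' {x ∈ C | ¬ IsTraversedAt C x}).Countable :=
    MapsTo.countable_of_injOn (f := edgeMap ℓ e) (fun _ ht => ht.2)
      ((injOn_edgeMap e).mono inter_subset_left) hC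
  refine measure_mono_null ?_ ((hcount.union (to_countable {0, ℓ e})).measure_zero volume)
  rintro t ⟨htT, hnot⟩
  rw [edgeTrace_eq] at htT
  rcases eq_endpoints_or_mem_Ioo_of_mem_Icc htT.1 with rfl | rfl | ht
  · exact .inr (.inl rfl)
  · exact .inr (.inr rfl)
  · exact .inl ⟨ht, htT.2, fun h => hnot (mem_interior_edgeTrace_of_isTraversedAt ht h)⟩

theorem tsum_halfEdgeLength (hC : {x ∈ C | ¬ IsTraversedAt C x}.Countable) :
    ∑' p : maxHalfEdgesIn ℓ C, halfEdgeLength p.1 = ∑' e, volume (edgeTrace ℓ C e) := by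
  rw [tsum_subtype (maxHalfEdgesIn ℓ C) halfEdgeLength, ENNReal.tsum_prod']
  refine tsum_congr fun e => ?_
  rw [← tsum_measure_maximalConnected (volume_edgeTrace_sdiff_interior hC e),
    tsum_subtype (maximalConnected (edgeTrace ℓ C e)) fun J => volume J]
  rfl

end Traces

end LengthGraph

theorem mainTheorem6 {V : Type*} (G : SimpleGraph V) (ℓ : G.edgeSet → ℝ) (hℓ : ∀ e, 0 < ℓ e)
    (hsum : Summable ℓ) :
    (∀ C : Set (LengthGraph.Space G ℓ), IsCircle C →
      HasLength C (∑' e : LengthGraph.edgesIn ℓ C, ENNReal.ofReal (ℓ e))) ∧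
    (∀ C : Set (LengthGraph.Space G ℓ), IsArc C →
      (∀ x, IsEndpoint C x → ¬ LengthGraph.IsInnerPoint ℓ x) →
      HasLength C (∑' e : LengthGraph.edgesIn ℓ C, ENNReal.ofReal (ℓ e))) ∧
    (∀ C : Set (LengthGraph.Space G ℓ), IsArc C →
      HasLength C (∑' p : LengthGraph.maxHalfEdgesIn ℓ C, LengthGraph.halfEdgeLength p.1)) := by
  have : Countable G.edgeSet := by
    rw [← countable_univ_iff, ← Function.support_eq_univ fun e => (hℓ e).ne']
    exact hsum.countable_support
  have hlength : ∀ {C : Set (LengthGraph.Space G ℓ)} {γ}, IsParametrization C γ →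
      HasLength C (∑' e, MeasureTheory.volume (LengthGraph.edgeTrace ℓ C e)) := fun hγ =>
    LengthGraph.hausdorffMeasure_eq_tsum_volume_edgeTrace hsum.tsum_ofReal_ne_top
      hγ.isPreconnected ▸ hγ.hasLength
  refine ⟨fun C hC => ?_, fun C hC hend => ?_, fun C hC => ?_⟩
  · obtain ⟨γ, hγ⟩ := hC.exists_isParametrization
    exact LengthGraph.tsum_volume_edgeTrace_of_isTraversedAt hγ.isClosed
      (fun x hx _ => hC.isTraversedAt hx) ▸ hlength hγ
  · obtain ⟨γ, hγ⟩ := hC.exists_isParametrization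
    exact LengthGraph.tsum_volume_edgeTrace_of_isTraversedAt hγ.isClosed
      (fun x hx hinner => hC.isTraversedAt hx fun hxend => hend x hxend hinner) ▸ hlength hγ
  · obtain ⟨γ, hγ⟩ := hC.exists_isParametrization
    exact LengthGraph.tsum_halfEdgeLength hC.finite_not_isTraversedAt.countable ▸ hlength hγ
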